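/- Lemma 6.4. Let $\mathcal F$ be a finite set of finite tournaments and let $m_{\mathcal F}$ be the maximum number of vertices of a tournament in $\mathcal F$. Call an oriented graph $\mathcal F$-free if no member of $\mathcal F$ embeds into it. Let $D_{\mathcal F}=(V,\to)$ be the countable homogeneous oriented graph (every isomorphism between finite induced subgraphs extends to an automorphism) whose finite induced subgraphs are, up to isomorphism, precisely the finite $\mathcal F$-free oriented graphs. Let $E=\{(x,y): x\to y \text{ or } y\to x\}$ and $H_{\mathcal F}=(V,E)$, and write $x\leftarrow y$ for $y\to x$. Let $R_1,\dots,R_m$ be relations on $V$, of arities $n_1,\dots,n_m$, that are first-order definable (without parameters) in $D_{\mathcal F}$ and consist of injective tuples inducing tournaments in $D_{\mathcal F}$, and let $\mathbb A=(H_{\mathcal F},R_1,\dots,R_m)$. A function $f\colon V^3\to V$ is a polymorphism of $\mathbb A$ if, applied componentwise, it preserves $E$ and $R_1,\dots,R_m$. It is $D_{\mathcal F}$-canonical if for all $\beta_1,\beta_2,\beta_3\in\operatorname{Aut}(D_{\mathcal F})$ and every finite $S\subseteq V^3$ there is $\alpha\in\operatorname{Aut}(D_{\mathcal F})$ with $f(x_1,x_2,x_3)=\alpha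 f(\beta_1(x_1),\beta_2(x_2),\beta_3(x_3))$ for all $(x_1,x_2,x_3)\in S$. It acts as an operation $c$ on $\{\leftarrow,\to\}$ if, whenever $O_1,O_2,O_3\in\{\leftarrow,\to\}$ and $p_i\in O_i$ for $i=1,2,3$, the pair obtained by applying $f$ componentwise to $p_1,p_2,p_3$ lies in $c(O_1,O_2,O_3)$. An operation $c$ is a minority if $c(x,y,y)=c(y,x,y)=c(y,y,x)=x$, and a majority if $c(x,x,y)=c(x,y,x)=c(y,x,x)=x$, for all $x,y$. For three orientations $D_1,D_2,D_3$ of the same undirected graph, $\operatorname{minority}(D_1,D_2,D_3)$ (respectively $\operatorname{majority}(D_1,D_2,D_3)$) is the oriented graph on the same vertices in which $(u,v)$ is an arc iff it is an arc of exactly one or three (respectively of two or three) of the $D_i$. A set of oriented graphs is preserved by the minority (majority) operation if applying this operation to any three members that orient the same graph yields a member. The standard representation of $R_i$ is the set of oriented graphs on $\{1,\dots,n_i\}$ obtained by pulling back $\to$ along $j\mapsto x_j$, for the tuples $x\in R_i$. Then the following two statements are equivalent. 1. There is a ternary polymorphism of $\mathbb A$ that is $D_{\mathcal F}$-canonical and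 acts as a minority on $\{\leftarrow,\to\}$. 2. For every $n\le m_{\mathcal F}$ the set of $\mathcal F$-free tournaments on $\{1,\dots,n\}$, and for every $i$ the standard representation of $R_i$, is preserved by the minority operation. The same equivalence holds with "majority" in place of "minority" in both statements. -/

import Mathlib

open FirstOrder FirstOrder.Language

universe u

namespace ForbiddenTournaments

/-! ### Oriented graphs and tournaments -/

/-- An oriented graph: the arc relation is antisymmetric and has no loops. -/
def IsOriented {W : Type*} (D : Digraph W) : Prop :=
  ∀ u v, D.Adj u v → ¬ D.Adj v u

/-- A tournament: an oriented graph in which any two distinct vertices are joined by an arc. -/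
def IsTournament {W : Type*} (D : Digraph W) : Prop :=
  IsOriented D ∧ ∀ u v, u ≠ v → D.Adj u v ∨ D.Adj v u

/-- A finite set of finite digraphs, each on a vertex set `Fin n`. Up to isomorphism every finite
set of finite tournaments is of this form. -/
abbrev FinFamily : Type := Finset (Σ n : ℕ, Digraph (Fin n))

/-- `D` is `ℱ`-free: no member of `ℱ` is isomorphic to an induced subgraph of `D`. -/
def IsFree (ℱ : FinFamily) {W : Type*} (D : Digraph W) : Prop :=
  ∀ T ∈ ℱ, IsEmpty (T.2.Adj ↪r D.Adj)

/-- The maximum number of vertices of a member of `ℱ` (and `0` if `ℱ` is empty). -/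
def maxSize (ℱ : FinFamily) : ℕ := ℱ.sup fun T => T.1

/-- The set of `ℱ`-free tournaments on a fixed set of `n` vertices. -/
def freeTournaments (ℱ : FinFamily) (n : ℕ) : Set (Digraph (Fin n)) :=
  {D | IsTournament D ∧ IsFree ℱ D}

/-- Pullback of a digraph along a map of vertex sets. -/
def pullback {W W' : Type*} (x : W → W') (D : Digraph W') : Digraph W where
  Adj i j := D.Adj (x i) (x j)

/-! ### Minority and majority of three orientations of the same graph -/

/-- `(u, v)` is an arc iff it is an arc of exactly one or of all three of the given digraphs. -/
def minority {W : Type*} (D₁ D₂ D₃ : Digraph W) : Digraph W where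
  Adj u v :=
    (D₁.Adj u v ∧ ¬ D₂.Adj u v ∧ ¬ D₃.Adj u v) ∨
    (¬ D₁.Adj u v ∧ D₂.Adj u v ∧ ¬ D₃.Adj u v) ∨
    (¬ D₁.Adj u v ∧ ¬ D₂.Adj u v ∧ D₃.Adj u v) ∨
    (D₁.Adj u v ∧ D₂.Adj u v ∧ D₃.Adj u v)

/-- `(u, v)` is an arc iff it is an arc of at least two of the three given digraphs. -/
def majority {W : Type*} (D₁ D₂ D₃ : Digraph W) : Digraph W where
  Adj u v :=
    (D₁.Adj u v ∧ D₂.Adj u v) ∨ (D₁.Adj u v ∧ D₃.Adj u v) ∨ (D₂.Adj u v ∧ D₃.Adj u v)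

/-- A set of oriented graphs on `W` is preserved by a ternary operation on digraphs if applying the
operation to three members that orient the same undirected graph yields a member. -/
def PreservedBy {W : Type*} (op : Digraph W → Digraph W → Digraph W → Digraph W)
    (S : Set (Digraph W)) : Prop :=
  ∀ D₁ ∈ S, ∀ D₂ ∈ S, ∀ D₃ ∈ S,
    D₁.toSimpleGraphInclusive = D₂.toSimpleGraphInclusive →
    D₁.toSimpleGraphInclusive = D₃.toSimpleGraphInclusive →
    op D₁ D₂ D₃ ∈ S

/-! ### The universal homogeneous `ℱ`-free oriented graph

Digraphs are viewed as first-order structures over the language `Language.graph`, which has a single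
binary relation symbol `adj` and no axioms; `adj` is interpreted by the arc relation. -/

/-- The arc relation of a structure over the language with one binary relation symbol. -/
def arcs (V : Type*) [Language.graph.Structure V] : Digraph V where
  Adj x y := Structure.RelMap Language.adj ![x, y]

/-- The class of all finite `ℱ`-free oriented graphs. -/
def freeClass (ℱ : FinFamily) : Set (CategoryTheory.Bundled.{u} Language.graph.Structure) :=
  {G | Finite G ∧ IsOriented (arcs G) ∧ IsFree ℱ (arcs G)}

/-- `V` is the countable homogeneous oriented graph whose finite induced subgraphs are, up to
isomorphism, precisely the finite `ℱ`-free oriented graphs. -/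
def IsUniversalHomogeneous (ℱ : FinFamily) (V : Type u) [Countable V]
    [Language.graph.Structure V] : Prop :=
  IsFraisseLimit (freeClass.{u} ℱ) V

/-! ### Relations, polymorphisms, canonical functions -/

section

variable {V : Type u}

/-- The `n`-ary operation `f` preserves the `k`-ary relation `R`. -/
def Preserves {n k : ℕ} (f : (Fin n → V) → V) (R : Set (Fin k → V)) : Prop :=
  ∀ t : Fin n → Fin k → V, (∀ i, t i ∈ R) → (fun j => f fun i => t i j) ∈ R

variable [Language.graph.Structure V]

variable (V) in
/-- The edge relation of the underlying undirected graph. -/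
def edgeRel : Set (Fin 2 → V) :=
  {x | (arcs V).Adj (x 0) (x 1) ∨ (arcs V).Adj (x 1) (x 0)}

/-- `f` is a polymorphism of the expansion of the underlying undirected graph of `V` by the
relations `R i`. -/
def IsPolymorphism {m : ℕ} {k : Fin m → ℕ} (R : ∀ i, Set (Fin (k i) → V)) {n : ℕ}
    (f : (Fin n → V) → V) : Prop :=
  Preserves f (edgeRel V) ∧ ∀ i, Preserves f (R i)

/-- The set of digraphs on `{1, …, k}` pulled back from the arc relation of `V` along the tuples
in `R`. -/
def standardRepresentation {k : ℕ} (R : Set (Fin k → V)) : Set (Digraph (Fin k)) :=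
  {G | ∃ x ∈ R, G = pullback x (arcs V)}

/-- `f` lies in the closure, for the topology of pointwise convergence, of the set of all `α ∘ g`
with `α` an automorphism: on every finite set of arguments `f` agrees with some `α ∘ g`. -/
def EquivModAut {n : ℕ} (f g : (Fin n → V) → V) : Prop :=
  ∀ S : Finset (Fin n → V), ∃ α : V ≃[Language.graph] V, ∀ x ∈ S, f x = α (g x)

/-- `f` is canonical with respect to the oriented graph `V`: it is equivalent to
`f (β₁ x₁, …, βₙ xₙ)` for all automorphisms `β₁, …, βₙ`. -/
def IsCanonical {n : ℕ} (f : (Fin n → V) → V) : Prop :=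
  ∀ β : Fin n → (V ≃[Language.graph] V), EquivModAut f fun x => f fun i => β i (x i)

variable (V) in
/-- The two sets of adjacent pairs: `true` stands for `→` and `false` for `←`. -/
def arcOrbit : Bool → Set (V × V)
  | true => {p | (arcs V).Adj p.1 p.2}
  | false => {p | (arcs V).Adj p.2 p.1}

/-- The ternary operation `f`, applied componentwise to pairs, acts on `{←, →}` as `c`. -/
def ActsOnArcsAs (f : (Fin 3 → V) → V) (c : Bool → Bool → Bool → Bool) : Prop :=
  ∀ o₁ o₂ o₃ : Bool, ∀ p₁ ∈ arcOrbit V o₁, ∀ p₂ ∈ arcOrbit V o₂, ∀ p₃ ∈ arcOrbit V o₃,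
    (f ![p₁.1, p₂.1, p₃.1], f ![p₁.2, p₂.2, p₃.2]) ∈ arcOrbit V (c o₁ o₂ o₃)

end

/-- `m(x,y,y) = m(y,x,y) = m(y,y,x) = x`. -/
def IsMinorityOp {A : Type*} (c : A → A → A → A) : Prop :=
  ∀ x y, c x y y = x ∧ c y x y = x ∧ c y y x = x

/-- `m(x,x,y) = m(x,y,x) = m(y,x,x) = x`. -/
def IsMajorityOp {A : Type*} (c : A → A → A → A) : Prop :=
  ∀ x y, c x x y = x ∧ c x y x = x ∧ c y x x = x

end ForbiddenTournaments

/-! On a two-element set, the minority and majority identities determine the operation, because two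
of any three arguments coincide. Both operations commute with reversing all arcs, which is the only
property of `c` that the equivalence needs once the digraph operation is rewritten as `combine c`.

From a polymorphism to preservation: free tournaments are realised by tuples of `V`, and applying a
function acting as `c` to three tuples that induce tournaments yields a tuple inducing their
combination (`ActsOnArcsAs.pullback_eq_combine`).

Conversely, orient the triples adjacent in all three coordinates by `c`. A forbidden tournament in
this graph on `V³` would be a combination of three free tournaments of the same size, which
preservation excludes (`isFree_combine`). Hence this countable graph embeds into `V`, and the
embedding is the required function. By homogeneity it is canonical, since automorphisms applied in
each coordinate do not change the product graph, and it preserves each `R i`, since a definable set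
is a union of automorphism orbits. -/

namespace ForbiddenTournaments

/-! ### Structures over the language of graphs -/

/-- The structure over the language with one binary relation symbol given by a digraph. -/
@[reducible]
def digraphStructure {W : Type*} (D : Digraph W) : Language.graph.Structure W where
  funMap f := nomatch f
  RelMap | .adj => fun x => D.Adj (x 0) (x 1)

/-- An injection that preserves and reflects arcs is an embedding of structures. -/
def embeddingOfArcs {M N : Type*} [Language.graph.Structure M] [Language.graph.Structure N]
    (f : M → N) (hf : Function.Injective f)
    (h : ∀ u v, (arcs N).Adj (f u) (f v) ↔ (arcs M).Adj u v) : M ↪[Language.graph] N where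
  toFun := f
  inj' := hf
  map_fun' g := nomatch g
  map_rel' {n} r x := by
    cases r
    have e₁ : x = ![x 0, x 1] := by ext i; fin_cases i <;> rfl
    have e₂ : f ∘ x = ![f (x 0), f (x 1)] := by ext i; fin_cases i <;> rfl
    rw [e₂]
    conv_rhs => rw [e₁]
    exact h (x 0) (x 1)

theorem arcs_map_iff {M N : Type*} [Language.graph.Structure M] [Language.graph.Structure N]
    (f : M ↪[Language.graph] N) (u v : M) :
    (arcs N).Adj (f u) (f v) ↔ (arcs M).Adj u v := by
  have := f.map_rel Language.adj ![u, v]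
  simp only [arcs, ← this]
  have e : f ∘ ![u, v] = ![f u, f v] := by
    ext i; fin_cases i <;> rfl
  rw [e]

theorem arcs_equiv_iff {M : Type*} [Language.graph.Structure M] (α : M ≃[Language.graph] M)
    (u v : M) : (arcs M).Adj (α u) (α v) ↔ (arcs M).Adj u v :=
  arcs_map_iff α.toEmbedding u v

/-! ### Freeness -/

theorem isFree_pullback {ℱ : FinFamily} {W W' : Type*} {D : Digraph W'} (hD : IsFree ℱ D)
    {x : W → W'} (hx : Function.Injective x) : IsFree ℱ (pullback x D) := fun T hT =>
  ⟨fun e => (hD T hT).false ⟨⟨fun i => x (e i), hx.comp e.injective⟩, e.map_rel_iff⟩⟩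

theorem isOriented_pullback {W W' : Type*} {D : Digraph W'} (hD : IsOriented D)
    (x : W → W') : IsOriented (pullback x D) := fun u v => hD (x u) (x v)

theorem IsOriented.ne {W : Type*} {D : Digraph W} (hD : IsOriented D) {u v : W}
    (h : D.Adj u v) : u ≠ v := by
  rintro rfl
  exact hD u u h h

theorem IsTournament.toSimpleGraphInclusive_eq_top {W : Type*} {D : Digraph W}
    (hD : IsTournament D) : D.toSimpleGraphInclusive = ⊤ := by
  ext u v
  simpa [Digraph.toSimpleGraphInclusive] using hD.2 u v

theorem IsOriented.injective_of_isTournament_pullback {W W' : Type*} {D : Digraph W'}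
    (hD : IsOriented D) {x : W → W'} (hx : IsTournament (pullback x D)) :
    Function.Injective x := by
  intro i j hij
  by_contra hne
  rcases hx.2 i j hne with h | h
  · exact hD.ne h hij
  · exact hD.ne h hij.symm

/-- For a family of tournaments, freeness passes to pullbacks along arbitrary maps. -/
theorem isFree_pullback_of_isTournament {ℱ : FinFamily} (hℱ : ∀ T ∈ ℱ, IsTournament T.2)
    {W W' : Type*} {D : Digraph W'} (hD : IsOriented D) (hfree : IsFree ℱ D) (x : W → W') :
    IsFree ℱ (pullback x D) := fun T hT =>
  ⟨fun e => (hfree T hT).false ⟨⟨fun i => x (e i), by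
    -- Distinct vertices of a tournament are joined by an arc, so identifying them would create a
    -- loop in `D`.
    intro i j hij
    by_contra hne
    rcases (hℱ T hT).2 i j hne with h | h
    · exact hD.ne (e.map_rel_iff.2 h) hij
    · exact hD.ne (e.map_rel_iff.2 h) hij.symm⟩, e.map_rel_iff⟩⟩

/-! ### The universal homogeneous graph -/

namespace IsUniversalHomogeneous

variable {ℱ : FinFamily} {V : Type u} [Countable V] [Language.graph.Structure V]

/-- Orientedness concerns two vertices and forbidden tournaments are finite, so this is enough to
transfer both properties to all of `V`. -/
theorem substructure_mem (hV : IsUniversalHomogeneous ℱ V) {S : Set V} (hS : S.Finite) :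
    IsOriented (pullback ((↑) : S → V) (arcs V)) ∧
      IsFree ℱ (pullback ((↑) : S → V) (arcs V)) := by
  let _ : Language.graph.Structure S := digraphStructure (pullback ((↑) : S → V) (arcs V))
  have : Finite S := hS
  have h : (CategoryTheory.Bundled.of S : CategoryTheory.Bundled Language.graph.Structure) ∈
      Language.graph.age V :=
    ⟨Structure.fg_iff_finite.2 this,
      ⟨embeddingOfArcs (M := S) (↑) Subtype.val_injective fun _ _ => Iff.rfl⟩⟩
  rw [hV.age] at h
  exact h.2

theorem isOriented (hV : IsUniversalHomogeneous ℱ V) : IsOriented (arcs V) := fun u v =>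
  (hV.substructure_mem (S := {u, v}) (by simp)).1 ⟨u, by simp⟩ ⟨v, by simp⟩

theorem isFree (hV : IsUniversalHomogeneous ℱ V) : IsFree ℱ (arcs V) := fun T hT =>
  ⟨fun e => ((hV.substructure_mem (Set.finite_range e)).2 T hT).false
    ⟨⟨fun i => ⟨e i, i, rfl⟩, fun _ _ h => e.injective (Subtype.ext_iff.1 h)⟩, e.map_rel_iff⟩⟩

theorem exists_embedding_of_finite (hV : IsUniversalHomogeneous ℱ V) {W : Type u} [Finite W]
    [Language.graph.Structure W] (h₁ : IsOriented (arcs W)) (h₂ : IsFree ℱ (arcs W)) :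
    Nonempty (W ↪[Language.graph] V) := by
  have h : (CategoryTheory.Bundled.of W : CategoryTheory.Bundled Language.graph.Structure) ∈
      Language.graph.age V := by
    rw [hV.age]
    exact ⟨‹Finite W›, h₁, h₂⟩
  exact h.2

theorem exists_pullback_eq (hV : IsUniversalHomogeneous ℱ V) {n : ℕ} {D : Digraph (Fin n)}
    (h₁ : IsOriented D) (h₂ : IsFree ℱ D) :
    ∃ x : Fin n → V, Function.Injective x ∧ D = pullback x (arcs V) := by
  -- Members of the age of `V` must live in the universe of `V`.
  let _ : Language.graph.Structure (ULift.{u} (Fin n)) :=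
    digraphStructure (pullback ULift.down D)
  obtain ⟨e⟩ := hV.exists_embedding_of_finite (W := ULift.{u} (Fin n))
    (isOriented_pullback h₁ ULift.down) (isFree_pullback h₂ ULift.down_injective)
  refine ⟨fun i => e ⟨i⟩, fun i j h => ULift.up_injective (e.injective h), ?_⟩
  ext i j
  exact (arcs_map_iff e ⟨i⟩ ⟨j⟩).symm

/-- Every countable `ℱ`-free oriented graph embeds. -/
theorem exists_embedding_of_countable (hV : IsUniversalHomogeneous ℱ V) {W : Type u}
    [Countable W] [Language.graph.Structure W] (h₁ : IsOriented (arcs W))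
    (h₂ : IsFree ℱ (arcs W)) : Nonempty (W ↪[Language.graph] V) := by
  have hsub (S : Language.graph.Substructure W) (hS : S.FG) :
      Nonempty (S ↪[Language.graph] V) := by
    have : Finite S := hS.finite
    have harcs : arcs S = pullback ((↑) : S → W) (arcs W) := by
      ext u v
      exact (arcs_map_iff S.subtype u v).symm
    refine hV.exists_embedding_of_finite (W := S) ?_ ?_ <;> rw [harcs]
    · exact isOriented_pullback h₁ _
    · exact isFree_pullback h₂ Subtype.val_injective
  -- One-point extension: the enlarged finite substructure embeds into `V` somehow, and
  -- ultrahomogeneity corrects that embedding so that it extends `f`.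
  have hext : Language.graph.IsExtensionPair W V := by
    rw [isExtensionPair_iff_exists_embedding_closure_singleton_sup]
    intro S hS f m
    have := hsub (Substructure.closure Language.graph {m} ⊔ S)
      ((Substructure.fg_closure_singleton _).sup hS)
    exact hV.ultrahomogeneous.extend_embedding (S.fg_iff_structure_fg.1 hS) f _
  obtain ⟨e⟩ := hsub ⊥ Substructure.fg_bot
  obtain ⟨f, -⟩ := embedding_from_cg (Structure.cg_of_countable)
    ⟨⟨⊥, e.toHom.range, e.equivRange⟩, Substructure.fg_bot⟩ hext
  exact ⟨f⟩

/-- Homogeneity, for finite families of vertices. -/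
theorem exists_equiv_apply_eq (hV : IsUniversalHomogeneous ℱ V) {ι : Type*} [Finite ι]
    {x y : ι → V} (heq : ∀ i j, x i = x j ↔ y i = y j)
    (hadj : ∀ i j, (arcs V).Adj (x i) (x j) ↔ (arcs V).Adj (y i) (y j)) :
    ∃ α : V ≃[Language.graph] V, ∀ i, y i = α (x i) := by
  let S : Language.graph.Substructure V := Substructure.closure Language.graph (Set.range x)
  have hmem (v : V) : v ∈ S ↔ ∃ i, x i = v := by
    simp [S, Substructure.mem_closure_iff_of_isRelational]
  -- The family `x` may have repetitions; `heq` makes `y ∘ g` independent of the chosen indices.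
  choose g hg using fun v : S => (hmem v).1 v.2
  let e : S ↪[Language.graph] V := embeddingOfArcs (fun v => y (g v))
    (fun u v h => Subtype.ext (by rw [← hg u, ← hg v]; exact (heq _ _).2 h))
    (fun u v => by
      rw [← hadj, hg, hg]
      exact arcs_map_iff S.subtype u v)
  obtain ⟨α, hα⟩ := hV.ultrahomogeneous S (Substructure.fg_closure (Set.finite_range x)) e
  refine ⟨α, fun i => ?_⟩
  have h := DFunLike.congr_fun hα ⟨x i, (hmem _).2 ⟨i, rfl⟩⟩
  refine Eq.trans ?_ h
  exact (heq _ _).1 (hg ⟨x i, (hmem _).2 ⟨i, rfl⟩⟩).symm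

end IsUniversalHomogeneous

/-! ### Combining three digraphs by an operation on orientations -/

/-- `(u, v)` is an arc iff `u` and `v` are adjacent in all three digraphs and `c` maps the three
orientations of this pair to `true`. -/
def combine {W : Type*} (c : Bool → Bool → Bool → Bool) (D₁ D₂ D₃ : Digraph W) : Digraph W where
  Adj u v := ∃ o₁ o₂ o₃, (bif o₁ then D₁.Adj u v else D₁.Adj v u) ∧
    (bif o₂ then D₂.Adj u v else D₂.Adj v u) ∧
    (bif o₃ then D₃.Adj u v else D₃.Adj v u) ∧ c o₁ o₂ o₃ = true

section combine

variable {W : Type*} {c : Bool → Bool → Bool → Bool} {D₁ D₂ D₃ : Digraph W}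

theorem IsOriented.eq_not {D : Digraph W} (h : IsOriented D) {u v : W} {o o' : Bool}
    (h₁ : bif o then D.Adj u v else D.Adj v u) (h₂ : bif o' then D.Adj v u else D.Adj u v) :
    o' = !o := by
  cases o <;> cases o' <;> simp at h₁ h₂ ⊢
  · exact h _ _ h₂ h₁
  · exact h _ _ h₁ h₂

theorem exists_orientation {D : Digraph W} {u v : W} (h : D.Adj u v ∨ D.Adj v u) :
    ∃ o : Bool, bif o then D.Adj u v else D.Adj v u := by
  rcases h with h | h
  · exact ⟨true, h⟩
  · exact ⟨false, h⟩

theorem adj_or_adj_of_orientation {D : Digraph W} {u v : W} {o : Bool}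
    (h : bif o then D.Adj u v else D.Adj v u) : D.Adj u v ∨ D.Adj v u := by
  cases o
  · exact Or.inr h
  · exact Or.inl h

theorem isOriented_combine (hc : ∀ a b d, c (!a) (!b) (!d) = !c a b d) (h₁ : IsOriented D₁)
    (h₂ : IsOriented D₂) (h₃ : IsOriented D₃) : IsOriented (combine c D₁ D₂ D₃) := by
  rintro u v ⟨o₁, o₂, o₃, a₁, a₂, a₃, a⟩ ⟨p₁, p₂, p₃, b₁, b₂, b₃, b⟩
  rw [h₁.eq_not a₁ b₁, h₂.eq_not a₂ b₂, h₃.eq_not a₃ b₃, hc, a] at b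
  cases b

/-- An arc of the combination forces adjacency in each `Dᵢ`. On a copy of a forbidden tournament all
three therefore induce free tournaments, on at most `maxSize ℱ` vertices, and `hpres` makes their
combination free. -/
theorem isFree_combine {ℱ : FinFamily} (hℱ : ∀ T ∈ ℱ, IsTournament T.2)
    (hpres : ∀ n ≤ maxSize ℱ, PreservedBy (combine c) (freeTournaments ℱ n))
    (h₁ : IsOriented D₁) (h₂ : IsOriented D₂) (h₃ : IsOriented D₃)
    (f₁ : IsFree ℱ D₁) (f₂ : IsFree ℱ D₂) (f₃ : IsFree ℱ D₃) :
    IsFree ℱ (combine c D₁ D₂ D₃) := by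
  refine fun T hT => ⟨fun e => ?_⟩
  have hadj : ∀ u v, u ≠ v → (combine c D₁ D₂ D₃).Adj (e u) (e v) ∨
      (combine c D₁ D₂ D₃).Adj (e v) (e u) := fun u v huv =>
    ((hℱ T hT).2 u v huv).imp e.map_rel_iff.2 e.map_rel_iff.2
  have key : ∀ D : Digraph W, IsOriented D → IsFree ℱ D →
      (∀ u v, (combine c D₁ D₂ D₃).Adj u v → D.Adj u v ∨ D.Adj v u) →
      pullback e D ∈ freeTournaments ℱ T.1 := fun D hD fD h =>
    ⟨⟨isOriented_pullback hD e, fun u v huv => (hadj u v huv).elim (h _ _) fun a => (h _ _ a).symm⟩,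
      isFree_pullback fD e.injective⟩
  have k₁ := key D₁ h₁ f₁ fun u v ⟨_, _, _, a, _⟩ => adj_or_adj_of_orientation a
  have k₂ := key D₂ h₂ f₂ fun u v ⟨_, _, _, _, a, _⟩ => adj_or_adj_of_orientation a
  have k₃ := key D₃ h₃ f₃ fun u v ⟨_, _, _, _, _, a, _⟩ => adj_or_adj_of_orientation a
  have := hpres T.1 (Finset.le_sup (f := fun T => T.1) hT) _ k₁ _ k₂ _ k₃
    (by rw [k₁.1.toSimpleGraphInclusive_eq_top, k₂.1.toSimpleGraphInclusive_eq_top])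
    (by rw [k₁.1.toSimpleGraphInclusive_eq_top, k₃.1.toSimpleGraphInclusive_eq_top])
  -- Combining commutes with pullback along `e`, so the identity embeds `T` into the combined
  -- tournament.
  exact (this.2 T hT).false ⟨⟨id, Function.injective_id⟩, e.map_rel_iff⟩

theorem isTournament_combine (hc : ∀ a b d, c (!a) (!b) (!d) = !c a b d) (h₁ : IsTournament D₁)
    (h₂ : IsTournament D₂) (h₃ : IsTournament D₃) : IsTournament (combine c D₁ D₂ D₃) := by
  refine ⟨isOriented_combine hc h₁.1 h₂.1 h₃.1, fun u v huv => ?_⟩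
  obtain ⟨o₁, a₁⟩ := exists_orientation (h₁.2 u v huv)
  obtain ⟨o₂, a₂⟩ := exists_orientation (h₂.2 u v huv)
  obtain ⟨o₃, a₃⟩ := exists_orientation (h₃.2 u v huv)
  cases hval : c o₁ o₂ o₃
  · refine Or.inr ⟨!o₁, !o₂, !o₃, ?_, ?_, ?_, by rw [hc, hval]; rfl⟩
    · cases o₁ <;> exact a₁
    · cases o₂ <;> exact a₂
    · cases o₃ <;> exact a₃
  · exact Or.inl ⟨o₁, o₂, o₃, a₁, a₂, a₃, hval⟩

/-! ### Minority and majority as operations on orientations -/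

theorem IsMinorityOp.map_not {c : Bool → Bool → Bool → Bool} (hc : IsMinorityOp c) (a b d : Bool) :
    c (!a) (!b) (!d) = !c a b d := by
  have h := fun x y => (hc x y).1
  have h' := fun x y => (hc x y).2.1
  have h'' := fun x y => (hc x y).2.2
  cases a <;> cases b <;> cases d <;> simp [h, h', h'']

theorem IsMajorityOp.map_not {c : Bool → Bool → Bool → Bool} (hc : IsMajorityOp c) (a b d : Bool) :
    c (!a) (!b) (!d) = !c a b d := by
  have h := fun x y => (hc x y).1
  have h' := fun x y => (hc x y).2.1
  have h'' := fun x y => (hc x y).2.2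
  cases a <;> cases b <;> cases d <;> simp [h, h', h'']

theorem IsTournament.adj_swap_iff {D : Digraph W} (h : IsTournament D) {u v : W} (huv : u ≠ v) :
    D.Adj v u ↔ ¬ D.Adj u v :=
  ⟨fun a b => h.1 _ _ a b, fun a => (h.2 u v huv).resolve_left a⟩

/-- In a tournament a non-arc between distinct vertices is a reversed arc, so counting arcs amounts
to evaluating `c` on orientations. -/
theorem minority_eq_combine (hc : IsMinorityOp c) (h₁ : IsTournament D₁) (h₂ : IsTournament D₂)
    (h₃ : IsTournament D₃) : minority D₁ D₂ D₃ = combine c D₁ D₂ D₃ := by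
  have e := fun x y => (hc x y).1
  have e' := fun x y => (hc x y).2.1
  have e'' := fun x y => (hc x y).2.2
  ext u v
  by_cases huv : u = v
  · subst huv
    have n₁ : ¬ D₁.Adj u u := fun h => h₁.1.ne h rfl
    have n₂ : ¬ D₂.Adj u u := fun h => h₂.1.ne h rfl
    have n₃ : ¬ D₃.Adj u u := fun h => h₃.1.ne h rfl
    simp [minority, combine, n₁, n₂, n₃]
  · simp only [minority, combine, Bool.exists_bool, e, e', e'', cond_true, cond_false,
      h₁.adj_swap_iff huv, h₂.adj_swap_iff huv, h₃.adj_swap_iff huv]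
    by_cases a₁ : D₁.Adj u v <;> by_cases a₂ : D₂.Adj u v <;> by_cases a₃ : D₃.Adj u v <;>
      simp [a₁, a₂, a₃]

theorem majority_eq_combine (hc : IsMajorityOp c) (h₁ : IsTournament D₁) (h₂ : IsTournament D₂)
    (h₃ : IsTournament D₃) : majority D₁ D₂ D₃ = combine c D₁ D₂ D₃ := by
  have e := fun x y => (hc x y).1
  have e' := fun x y => (hc x y).2.1
  have e'' := fun x y => (hc x y).2.2
  ext u v
  by_cases huv : u = v
  · subst huv
    have n₁ : ¬ D₁.Adj u u := fun h => h₁.1.ne h rfl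
    have n₂ : ¬ D₂.Adj u u := fun h => h₂.1.ne h rfl
    have n₃ : ¬ D₃.Adj u u := fun h => h₃.1.ne h rfl
    simp [majority, combine, n₁, n₂, n₃]
  · simp only [majority, combine, Bool.exists_bool, e, e', e'', cond_true, cond_false,
      h₁.adj_swap_iff huv, h₂.adj_swap_iff huv, h₃.adj_swap_iff huv]
    by_cases a₁ : D₁.Adj u v <;> by_cases a₂ : D₂.Adj u v <;> by_cases a₃ : D₃.Adj u v <;>
      simp [a₁, a₂, a₃]

theorem preservedBy_congr {op op' : Digraph W → Digraph W → Digraph W → Digraph W}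
    {S : Set (Digraph W)} (hS : ∀ D ∈ S, IsTournament D)
    (h : ∀ D₁ D₂ D₃, IsTournament D₁ → IsTournament D₂ → IsTournament D₃ →
      op D₁ D₂ D₃ = op' D₁ D₂ D₃) :
    PreservedBy op S ↔ PreservedBy op' S := by
  refine forall₂_congr fun D₁ h₁ => forall₂_congr fun D₂ h₂ => forall₂_congr fun D₃ h₃ => ?_
  rw [h _ _ _ (hS _ h₁) (hS _ h₂) (hS _ h₃)]

end combine

/-! ### Functions acting on arcs -/

section action

variable {V : Type u} [Language.graph.Structure V] {c : Bool → Bool → Bool → Bool}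

theorem mem_arcOrbit_iff {o : Bool} {u v : V} :
    (u, v) ∈ arcOrbit V o ↔ bif o then (arcs V).Adj u v else (arcs V).Adj v u := by
  cases o <;> rfl

theorem ActsOnArcsAs.mem {f : (Fin 3 → V) → V} (hf : ActsOnArcsAs f c) {x y : Fin 3 → V}
    {o₁ o₂ o₃ : Bool} (h₁ : (x 0, y 0) ∈ arcOrbit V o₁) (h₂ : (x 1, y 1) ∈ arcOrbit V o₂)
    (h₃ : (x 2, y 2) ∈ arcOrbit V o₃) : (f x, f y) ∈ arcOrbit V (c o₁ o₂ o₃) := by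
  have e : ∀ z : Fin 3 → V, z = ![z 0, z 1, z 2] := fun z => by
    ext i; fin_cases i <;> rfl
  rw [e x, e y]
  exact hf _ _ _ _ h₁ _ h₂ _ h₃

theorem ActsOnArcsAs.pullback_eq_combine {f : (Fin 3 → V) → V} (hf : ActsOnArcsAs f c)
    (hV : IsOriented (arcs V)) {W : Type*} {t : Fin 3 → W → V}
    (ht : ∀ i, IsTournament (pullback (t i) (arcs V))) :
    pullback (fun j => f fun i => t i j) (arcs V) =
      combine c (pullback (t 0) (arcs V)) (pullback (t 1) (arcs V))
        (pullback (t 2) (arcs V)) := by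
  ext u v
  constructor
  · intro h
    have huv : u ≠ v := by
      rintro rfl
      exact hV.ne h rfl
    obtain ⟨o₁, a₁⟩ := exists_orientation ((ht 0).2 u v huv)
    obtain ⟨o₂, a₂⟩ := exists_orientation ((ht 1).2 u v huv)
    obtain ⟨o₃, a₃⟩ := exists_orientation ((ht 2).2 u v huv)
    refine ⟨o₁, o₂, o₃, a₁, a₂, a₃, ?_⟩
    have := hf.mem (x := fun i => t i u) (y := fun i => t i v) (mem_arcOrbit_iff.2 a₁)
      (mem_arcOrbit_iff.2 a₂) (mem_arcOrbit_iff.2 a₃)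
    cases hval : c o₁ o₂ o₃
    -- The value `false` would give an arc opposite to `h`.
    · rw [hval] at this
      exact (hV _ _ h this).elim
    · rfl
  · rintro ⟨o₁, o₂, o₃, a₁, a₂, a₃, hval⟩
    have := hf.mem (x := fun i => t i u) (y := fun i => t i v) (mem_arcOrbit_iff.2 a₁)
      (mem_arcOrbit_iff.2 a₂) (mem_arcOrbit_iff.2 a₃)
    rwa [hval] at this

theorem mem_of_definable_of_equiv {k : ℕ} {R : Set (Fin k → V)}
    (hR : (∅ : Set V).Definable Language.graph R) (α : V ≃[Language.graph] V) {x : Fin k → V}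
    (hx : x ∈ R) : (fun j => α (x j)) ∈ R := by
  obtain ⟨φ, rfl⟩ := Set.empty_definable_iff.1 hR
  exact (StrongHomClass.realize_formula α φ).2 hx

/-- The product of three copies of the arc relation, oriented by the operation `c`. -/
def productDigraph (V : Type u) [Language.graph.Structure V] (c : Bool → Bool → Bool → Bool) :
    Digraph (Fin 3 → V) :=
  combine c (pullback (fun x => x 0) (arcs V)) (pullback (fun x => x 1) (arcs V))
    (pullback (fun x => x 2) (arcs V))

/-- Coordinate projections are not injective; freeness still pulls back along them because the
forbidden graphs are tournaments. -/
theorem isFree_productDigraph {ℱ : FinFamily} (hℱ : ∀ T ∈ ℱ, IsTournament T.2)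
    (hpres : ∀ n ≤ maxSize ℱ, PreservedBy (combine c) (freeTournaments ℱ n))
    (hV : IsOriented (arcs V)) (hfree : IsFree ℱ (arcs V)) :
    IsFree ℱ (productDigraph V c) :=
  isFree_combine hℱ hpres (isOriented_pullback hV _) (isOriented_pullback hV _)
    (isOriented_pullback hV _) (isFree_pullback_of_isTournament hℱ hV hfree _)
    (isFree_pullback_of_isTournament hℱ hV hfree _)
    (isFree_pullback_of_isTournament hℱ hV hfree _)

end action

/-! ### The equivalence for operations commuting with reversal -/

section equivalence

variable {ℱ : FinFamily} {V : Type u} [Countable V] [Language.graph.Structure V]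
  {c : Bool → Bool → Bool → Bool} {m : ℕ} {k : Fin m → ℕ} {R : ∀ i, Set (Fin (k i) → V)}

theorem preservedBy_combine_of_polymorphism (hV : IsUniversalHomogeneous ℱ V)
    (hc : ∀ a b d, c (!a) (!b) (!d) = !c a b d)
    (htour : ∀ i, ∀ x ∈ R i, Function.Injective x ∧ IsTournament (pullback x (arcs V)))
    {f : (Fin 3 → V) → V} (hf : IsPolymorphism R f) (hact : ActsOnArcsAs f c) :
    (∀ n, PreservedBy (combine c) (freeTournaments ℱ n)) ∧
      ∀ i, PreservedBy (combine c) (standardRepresentation (R i)) := by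
  constructor
  · rintro n D₁ h₁ D₂ h₂ D₃ h₃ - -
    obtain ⟨x₁, -, rfl⟩ := hV.exists_pullback_eq h₁.1.1 h₁.2
    obtain ⟨x₂, -, rfl⟩ := hV.exists_pullback_eq h₂.1.1 h₂.2
    obtain ⟨x₃, -, rfl⟩ := hV.exists_pullback_eq h₃.1.1 h₃.2
    have htour := isTournament_combine hc h₁.1 h₂.1 h₃.1
    have key := hact.pullback_eq_combine hV.isOriented (t := ![x₁, x₂, x₃])
      (by intro i; fin_cases i; exacts [h₁.1, h₂.1, h₃.1])
    refine ⟨htour, ?_⟩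
    change _ = combine c (pullback x₁ (arcs V)) (pullback x₂ (arcs V)) (pullback x₃ (arcs V))
      at key
    rw [← key] at htour ⊢
    -- The image tuple induces a tournament, so its entries are distinct and it spans an induced
    -- subgraph of `V`.
    exact isFree_pullback hV.isFree (hV.isOriented.injective_of_isTournament_pullback htour)
  · rintro i _ ⟨x₁, h₁, rfl⟩ _ ⟨x₂, h₂, rfl⟩ _ ⟨x₃, h₃, rfl⟩ - -
    refine ⟨_, hf.2 i ![x₁, x₂, x₃] (by intro j; fin_cases j; exacts [h₁, h₂, h₃]), ?_⟩
    exact (hact.pullback_eq_combine hV.isOriented (t := ![x₁, x₂, x₃])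
      (by intro j; fin_cases j; exacts [(htour i _ h₁).2, (htour i _ h₂).2, (htour i _ h₃).2])).symm

theorem exists_polymorphism_of_preservedBy_combine (hℱ : ∀ T ∈ ℱ, IsTournament T.2)
    (hV : IsUniversalHomogeneous ℱ V) (hc : ∀ a b d, c (!a) (!b) (!d) = !c a b d)
    (hdef : ∀ i, (∅ : Set V).Definable Language.graph (R i))
    (htour : ∀ i, ∀ x ∈ R i, Function.Injective x ∧ IsTournament (pullback x (arcs V)))
    (hpres : ∀ n ≤ maxSize ℱ, PreservedBy (combine c) (freeTournaments ℱ n))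
    (hR : ∀ i, PreservedBy (combine c) (standardRepresentation (R i))) :
    ∃ f : (Fin 3 → V) → V, IsPolymorphism R f ∧ IsCanonical f ∧ ActsOnArcsAs f c := by
  let _ : Language.graph.Structure (Fin 3 → V) := digraphStructure (productDigraph V c)
  have hor : IsOriented (productDigraph V c) :=
    isOriented_combine hc (isOriented_pullback hV.isOriented _) (isOriented_pullback hV.isOriented _)
      (isOriented_pullback hV.isOriented _)
  obtain ⟨f⟩ := hV.exists_embedding_of_countable (W := Fin 3 → V) hor
    (isFree_productDigraph hℱ hpres hV.isOriented hV.isFree)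
  have hadj : ∀ x y, (arcs V).Adj (f x) (f y) ↔ (productDigraph V c).Adj x y :=
    arcs_map_iff f
  have hact : ActsOnArcsAs f c := by
    rintro o₁ o₂ o₃ ⟨u₁, v₁⟩ h₁ ⟨u₂, v₂⟩ h₂ ⟨u₃, v₃⟩ h₃
    cases hval : c o₁ o₂ o₃
    -- For the value `false` the reversed pair must be an arc; reversing all three orientations
    -- negates `c`.
    · refine (hadj _ _).2 ⟨!o₁, !o₂, !o₃, ?_, ?_, ?_, by rw [hc, hval]; rfl⟩
      · cases o₁ <;> exact h₁
      · cases o₂ <;> exact h₂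
      · cases o₃ <;> exact h₃
    · exact (hadj _ _).2 ⟨o₁, o₂, o₃, mem_arcOrbit_iff.1 h₁, mem_arcOrbit_iff.1 h₂,
        mem_arcOrbit_iff.1 h₃, hval⟩
  refine ⟨f, ⟨fun t ht => ?_, fun i t ht => ?_⟩, fun β S => ?_, hact⟩
  · obtain ⟨o₁, a₁⟩ := exists_orientation (ht 0)
    obtain ⟨o₂, a₂⟩ := exists_orientation (ht 1)
    obtain ⟨o₃, a₃⟩ := exists_orientation (ht 2)
    exact adj_or_adj_of_orientation (mem_arcOrbit_iff.1 (hact.mem (x := fun i => t i 0)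
      (y := fun i => t i 1) (mem_arcOrbit_iff.2 a₁) (mem_arcOrbit_iff.2 a₂)
      (mem_arcOrbit_iff.2 a₃)))
  · have tour := fun j => (htour i _ (ht j)).2
    have key := hact.pullback_eq_combine hV.isOriented tour
    have hmem := hR i _ ⟨_, ht 0, rfl⟩ _ ⟨_, ht 1, rfl⟩ _ ⟨_, ht 2, rfl⟩
      (by rw [(tour 0).toSimpleGraphInclusive_eq_top, (tour 1).toSimpleGraphInclusive_eq_top])
      (by rw [(tour 0).toSimpleGraphInclusive_eq_top, (tour 2).toSimpleGraphInclusive_eq_top])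
    rw [← key] at hmem
    -- Preservation only yields some `x` in `R i` inducing the same tournament as the image tuple.
    -- Homogeneity supplies an automorphism between the two, and definability keeps the image in `R
    -- i`.
    obtain ⟨x, hx, hxt⟩ := hmem
    have hinj : Function.Injective fun j => f fun i => t i j := by
      apply hV.isOriented.injective_of_isTournament_pullback
      rw [hxt]
      exact (htour i x hx).2
    obtain ⟨α, hα⟩ := hV.exists_equiv_apply_eq (x := x) (y := fun j => f fun i => t i j)
      (fun a b => by rw [(htour i x hx).1.eq_iff, hinj.eq_iff])
      (fun a b => iff_of_eq (congrArg (fun D => D.Adj a b) hxt.symm))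
    rw [funext hα]
    exact mem_of_definable_of_equiv (hdef i) α hx
  -- Acting by `β` on the coordinates preserves equality and arcs of the product graph, and `f` is
  -- an embedding of it.
  · obtain ⟨α, hα⟩ := hV.exists_equiv_apply_eq (ι := S)
      (x := fun s => f fun i => β i (s.1 i)) (y := fun s => f s.1)
      (fun a b => by
        rw [f.injective.eq_iff, f.injective.eq_iff, funext_iff, funext_iff]
        exact forall_congr' fun i => (β i).injective.eq_iff)
      (fun a b => by
        rw [hadj, hadj]
        simp only [productDigraph, combine, pullback, arcs_equiv_iff])
    exact ⟨α, fun x hx => hα ⟨x, hx⟩⟩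

/-- The predicate `P` stands for being a minority or a majority operation, so one argument serves
both cases. -/
theorem exists_polymorphism_iff (hℱ : ∀ T ∈ ℱ, IsTournament T.2)
    (hV : IsUniversalHomogeneous ℱ V)
    (hdef : ∀ i, (∅ : Set V).Definable Language.graph (R i))
    (htour : ∀ i, ∀ x ∈ R i, Function.Injective x ∧ IsTournament (pullback x (arcs V)))
    {P : (Bool → Bool → Bool → Bool) → Prop} (hP : ∃ c, P c)
    (hnot : ∀ c, P c → ∀ a b d, c (!a) (!b) (!d) = !c a b d)
    {op : ∀ {n : ℕ}, Digraph (Fin n) → Digraph (Fin n) → Digraph (Fin n) → Digraph (Fin n)}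
    (hop : ∀ c, P c → ∀ {n : ℕ} (D₁ D₂ D₃ : Digraph (Fin n)), IsTournament D₁ →
      IsTournament D₂ → IsTournament D₃ → op D₁ D₂ D₃ = combine c D₁ D₂ D₃) :
    (∃ f : (Fin 3 → V) → V, IsPolymorphism R f ∧ IsCanonical f ∧
        ∃ c, P c ∧ ActsOnArcsAs f c) ↔
      (∀ n ≤ maxSize ℱ, PreservedBy op (freeTournaments ℱ n)) ∧
        ∀ i, PreservedBy op (standardRepresentation (R i)) := by
  have hfree (c) (hc : P c) (n : ℕ) : PreservedBy op (freeTournaments ℱ n) ↔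
      PreservedBy (combine c) (freeTournaments ℱ n) :=
    preservedBy_congr (fun D hD => hD.1) (hop c hc)
  have hrep (c) (hc : P c) (i : Fin m) : PreservedBy op (standardRepresentation (R i)) ↔
      PreservedBy (combine c) (standardRepresentation (R i)) :=
    preservedBy_congr (by rintro _ ⟨x, hx, rfl⟩; exact (htour i x hx).2) (hop c hc)
  constructor
  · rintro ⟨f, hf, -, c, hc, hact⟩
    obtain ⟨h₁, h₂⟩ := preservedBy_combine_of_polymorphism hV (hnot c hc) htour hf hact
    exact ⟨fun n _ => (hfree c hc n).2 (h₁ n), fun i => (hrep c hc i).2 (h₂ i)⟩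
  · rintro ⟨h₁, h₂⟩
    obtain ⟨c, hc⟩ := hP
    obtain ⟨f, hf, hcan, hact⟩ := exists_polymorphism_of_preservedBy_combine hℱ hV (hnot c hc)
      hdef htour (fun n hn => (hfree c hc n).1 (h₁ n hn)) fun i => (hrep c hc i).1 (h₂ i)
    exact ⟨f, hf, hcan, c, hc, hact⟩

end equivalence

end ForbiddenTournaments

theorem lemma6p4
    (ℱ : ForbiddenTournaments.FinFamily)
    (hℱ : ∀ T ∈ ℱ, ForbiddenTournaments.IsTournament T.2)
    {V : Type u} [Countable V] [FirstOrder.Language.graph.Structure V]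
    (hV : ForbiddenTournaments.IsUniversalHomogeneous ℱ V)
    {m : ℕ} {k : Fin m → ℕ} (R : ∀ i, Set (Fin (k i) → V))
    (hdef : ∀ i, (∅ : Set V).Definable FirstOrder.Language.graph (R i))
    (htour : ∀ i, ∀ x ∈ R i, Function.Injective x ∧
      ForbiddenTournaments.IsTournament
        (ForbiddenTournaments.pullback x (ForbiddenTournaments.arcs V))) :
    ((∃ f : (Fin 3 → V) → V,
        ForbiddenTournaments.IsPolymorphism R f ∧ ForbiddenTournaments.IsCanonical f ∧
        ∃ c, ForbiddenTournaments.IsMinorityOp c ∧ ForbiddenTournaments.ActsOnArcsAs f c) ↔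
      ((∀ n ≤ ForbiddenTournaments.maxSize ℱ,
          ForbiddenTournaments.PreservedBy ForbiddenTournaments.minority
            (ForbiddenTournaments.freeTournaments ℱ n)) ∧
        ∀ i, ForbiddenTournaments.PreservedBy ForbiddenTournaments.minority
          (ForbiddenTournaments.standardRepresentation (R i)))) ∧
    ((∃ f : (Fin 3 → V) → V,
        ForbiddenTournaments.IsPolymorphism R f ∧ ForbiddenTournaments.IsCanonical f ∧
        ∃ c, ForbiddenTournaments.IsMajorityOp c ∧ ForbiddenTournaments.ActsOnArcsAs f c) ↔
      ((∀ n ≤ ForbiddenTournaments.maxSize ℱ,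
          ForbiddenTournaments.PreservedBy ForbiddenTournaments.majority
            (ForbiddenTournaments.freeTournaments ℱ n)) ∧
        ∀ i, ForbiddenTournaments.PreservedBy ForbiddenTournaments.majority
          (ForbiddenTournaments.standardRepresentation (R i)))) := by

  open ForbiddenTournaments in
  exact ⟨exists_polymorphism_iff hℱ hV hdef htour
      ⟨fun a b d => xor a (xor b d), by unfold IsMinorityOp; decide⟩
      (fun _ hc => hc.map_not) (fun _ hc _ _ _ _ => minority_eq_combine hc),
    exists_polymorphism_iff hℱ hV hdef htour
      ⟨fun a b d => (a && b) || (a && d) || (b && d), by unfold IsMajorityOp; decide⟩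
      (fun _ hc => hc.map_not) (fun _ hc _ _ _ _ => majority_eq_combine hc)⟩
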